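/- \textbf{Corollary (blow-up of negative self-similar solutions).} Let $k_n=2^n$ and consider the unforced inviscid dyadic model \[ X_0(t)=0,\qquad \dot X_n(t)=k_{n-1}X_{n-1}^2(t)-k_nX_n(t)X_{n+1}(t),\quad n\ge 1 . \] A (componentwise) solution on an interval $I$ is a sequence $X=(X_n)$ of continuously differentiable real functions on $I$ that satisfies all these equations on $I$; it has finite energy if $\sum_{n\ge1}X_n(t)^2<\infty$ for every $t\in I$, it is positive (negative) if $X_n(t)\ge0$ (respectively $X_n(t)\le0$) for all $n\ge1$ and $t\in I$, and it is self-similar if there are real numbers $a_n$ and a function $\varphi$ with $X_n(t)=a_n\varphi(t)$ for all $n\ge1$, $t\in I$. For every $t_0>0$ and every integer $n_0\ge0$ there is a unique negative finite-energy self-similar solution $Y$ on $[0,t_0)$ of the form \[ Y_n(t)=\frac{a_n}{t-t_0},\qquad n\ge1,\ t\in[0,t_0),\qquad\text{with } a_1=\dots=a_{n_0}=0,\quad a_{n_0+1}\neq0 , \] and its coefficients $a_n$, $n\ge1$, are unique. $Y$ is also the unique negative finite-energy self-similar solution on $[0,t_0)$ of the general form $a_n\varphi(t)$, with $a_1=\dots=a_{n_0}=0$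 and $a_{n_0+1}\ne0$, that is maximal, i.e. that is not the restriction of a solution of the same kind on $[0,T)$ for some $T>t_0$. For every $n>n_0$ one has $a_n>0$, $Y_n<0$ on $[0,t_0)$ and $\lim_{t\to t_0^-}Y_n(t)=-\infty$; thus every component that does not vanish identically blows up at time $t_0$. Finally, there is a positive finite-energy self-similar solution of the form $X_n(t)=b_n/(t+t_0)$ on $(-t_0,\infty)$ with $b_1=\dots=b_{n_0}=0$ and $b_{n_0+1}\neq0$, one such solution has $b_n=a_n$ for all $n\ge1$, and every such solution satisfies $Y(t)=-X(-t)$ for $t\in[0,t_0)$. -/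

import Mathlib

open Set Filter Topology

/-- The coefficients `k_n = 2^n` of the dyadic model. -/
noncomputable def dyadicK (n : ℕ) : ℝ := 2 ^ n

/-- Componentwise solutions, on a time interval `I`, of the unforced inviscid dyadic model
`X_0 = 0`, `X_n' = k_{n-1} X_{n-1}^2 - k_n X_n X_{n+1}` for `n ≥ 1` (the equations below are
indexed by `n + 1`). At an end point that belongs to `I` the derivative is one-sided. -/
structure IsDyadicSolutionOn (I : Set ℝ) (X : ℕ → ℝ → ℝ) : Prop where
  zero : ∀ t ∈ I, X 0 t = 0
  contDiffOn : ∀ n, ContDiffOn ℝ 1 (X n) I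
  equation : ∀ n, ∀ t ∈ I,
    HasDerivWithinAt (X (n + 1))
      (dyadicK n * X n t ^ 2 - dyadicK (n + 1) * X (n + 1) t * X (n + 2) t) I t

/-- Finite energy on `I`: the sequence `(X_n(t))_{n ≥ 1}` is square summable for all `t ∈ I`. -/
def HasFiniteEnergyOn (I : Set ℝ) (X : ℕ → ℝ → ℝ) : Prop :=
  ∀ t ∈ I, Summable fun n : ℕ => X (n + 1) t ^ 2

/-- All components are non-negative on `I`. -/
def IsPositiveOn (I : Set ℝ) (X : ℕ → ℝ → ℝ) : Prop :=
  ∀ n, 1 ≤ n → ∀ t ∈ I, 0 ≤ X n t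

/-- All components are non-positive on `I`. -/
def IsNegativeOn (I : Set ℝ) (X : ℕ → ℝ → ℝ) : Prop :=
  ∀ n, 1 ≤ n → ∀ t ∈ I, X n t ≤ 0

/-- `a_1 = ⋯ = a_{n₀} = 0` and `a_{n₀+1} ≠ 0`. -/
def HasLeadingIndex (n₀ : ℕ) (a : ℕ → ℝ) : Prop :=
  (∀ n, 1 ≤ n → n ≤ n₀ → a n = 0) ∧ a (n₀ + 1) ≠ 0

/-- `X` is a finite energy self-similar solution on `I`, i.e. one of the form
`X_n(t) = a_n φ(t)`, with `a_1 = ⋯ = a_{n₀} = 0` and `a_{n₀+1} ≠ 0`. -/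
def IsSelfSimilarSolutionOn (I : Set ℝ) (n₀ : ℕ) (X : ℕ → ℝ → ℝ) : Prop :=
  IsDyadicSolutionOn I X ∧ HasFiniteEnergyOn I X ∧
    ∃ (a : ℕ → ℝ) (φ : ℝ → ℝ), HasLeadingIndex n₀ a ∧
      ∀ n, 1 ≤ n → ∀ t ∈ I, X n t = a n * φ t

/-- `X` is a finite energy self-similar solution on `I` of the form `X_n(t) = a_n / (t - τ)`,
with `a_1 = ⋯ = a_{n₀} = 0` and `a_{n₀+1} ≠ 0`. -/
def IsSelfSimilarSolutionWith (I : Set ℝ) (τ : ℝ) (n₀ : ℕ) (a : ℕ → ℝ) (X : ℕ → ℝ → ℝ) :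
    Prop :=
  IsDyadicSolutionOn I X ∧ HasFiniteEnergyOn I X ∧ HasLeadingIndex n₀ a ∧
    ∀ n, 1 ≤ n → ∀ t ∈ I, X n t = a n / (t - τ)

/-- `X` on `[0, T)` is a negative finite energy self-similar solution (of the general form
`a_n φ(t)`), with leading index `n₀ + 1`, that is not the restriction to `[0, T)` of such a
solution on a longer interval `[0, T')`. -/
def IsMaximalNegativeSelfSimilar (T : ℝ) (n₀ : ℕ) (X : ℕ → ℝ → ℝ) : Prop :=
  IsSelfSimilarSolutionOn (Ico 0 T) n₀ X ∧ IsNegativeOn (Ico 0 T) X ∧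
    ¬ ∃ T' : ℝ, T < T' ∧ ∃ X' : ℕ → ℝ → ℝ,
      IsSelfSimilarSolutionOn (Ico 0 T') n₀ X' ∧ IsNegativeOn (Ico 0 T') X' ∧
        ∀ n, ∀ t ∈ Ico (0 : ℝ) T, X' n t = X n t

/-!
`X_n(t) = c_n / (t - τ)` is a solution exactly when `c_0 = 0` and
`k_{n+1} c_{n+1} c_{n+2} = c_{n+1} + k_n c_n ^ 2`; leading zeros are removed by rescaling, so let
`c_1 > 0`. Then all `c_{n+1}` are positive and `c_{n+2} ≥ 1 / k_{n+1}`.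

*Uniqueness.* For two such sequences with `c_1 ≤ d_1` put `δ_n = (-1) ^ n (c_n - d_n)` and
`s_n = c_n + d_n`. Subtracting the recurrences gives
`δ_{n+2} s_{n+1} = δ_n s_n + δ_{n+1} (s_{n+2} - 1 / k_n)`, where the last factor is non-negative.
So all `δ_n` are non-negative, and multiplying the resulting inequalities
`δ_n s_n ≤ δ_{n+2} s_{n+1}` for `n` and `n + 1` shows that `δ_n δ_{n+1} s_n` does not decrease when
`n` grows by two. If `c_1 < d_1` it is positive at `n = 3`, yet finite energy forces it to tend to
zero.

*Existence.* If `c_n ≤ c_{n+1}` for some `n ≥ 2`, then the same holds at `n + 2, n + 4, …`, and the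
sequence decreases at the indices of the other parity. The initial values `c_1` for which the
sequence increases at some even index, or at some odd one, thus form disjoint open sets, neither of
them empty. As `(0, ∞)` is connected, some `c_1` lies in neither; its sequence is non-increasing
from `c_2` on, and then the recurrence makes it decay geometrically.

*General `φ`.* The first non-zero component satisfies `ψ' = -μ ψ²`. If it vanishes at time zero, it
vanishes identically and the solution can be extended; otherwise `ψ(t) = 1 / (μ (t - τ))`.
-/

/-- Coefficient sequences of self-similar solutions: `X_n(t) = c_n / (t - τ)` solves the dyadic
model exactly when `c` satisfies this recurrence, which does not involve `τ`. -/
structure IsDyadicProfile (c : ℕ → ℝ) : Prop where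
  zero : c 0 = 0
  recurrence : ∀ n, dyadicK (n + 1) * c (n + 1) * c (n + 2) = c (n + 1) + dyadicK n * c n ^ 2

lemma dyadicK_pos (n : ℕ) : 0 < dyadicK n := pow_pos two_pos n

lemma dyadicK_succ (n : ℕ) : dyadicK (n + 1) = 2 * dyadicK n := pow_succ' 2 n

lemma dyadicK_add (m n : ℕ) : dyadicK (m + n) = dyadicK m * dyadicK n := pow_add 2 m n

namespace IsDyadicProfile

section Positive

variable {c : ℕ → ℝ}

lemma pos (hc : IsDyadicProfile c) (h1 : 0 < c 1) (n : ℕ) : 0 < c (n + 1) := by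
  induction n with
  | zero => exact h1
  | succ n ih =>
    have hk := dyadicK_pos n
    have hprod : 0 < dyadicK (n + 1) * c (n + 1) * c (n + 2) := by
      rw [hc.recurrence n]
      positivity
    exact pos_of_mul_pos_right hprod (mul_pos (dyadicK_pos _) ih).le

lemma add_two_eq (hc : IsDyadicProfile c) (h1 : 0 < c 1) (n : ℕ) :
    c (n + 2) = 1 / dyadicK (n + 1) + c n ^ 2 / (2 * c (n + 1)) := by
  have hk := dyadicK_pos n
  have hp := hc.pos h1 n
  have h := hc.recurrence n
  rw [dyadicK_succ] at h ⊢
  field_simp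
  linarith

lemma one_div_dyadicK_le (hc : IsDyadicProfile c) (h1 : 0 < c 1) (n : ℕ) :
    1 / dyadicK (n + 1) ≤ c (n + 2) := by
  have hp := hc.pos h1 n
  rw [hc.add_two_eq h1]
  exact le_add_of_nonneg_right (by positivity)

lemma one_div_dyadicK_lt (hc : IsDyadicProfile c) (h1 : 0 < c 1) (n : ℕ) :
    1 / dyadicK (n + 2) < c (n + 3) := by
  have hp := hc.pos h1 n
  have hp' := hc.pos h1 (n + 1)
  rw [hc.add_two_eq h1]
  exact lt_add_of_pos_right _ (by positivity)

end Positive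

end IsDyadicProfile

/-! ### Uniqueness of profiles that tend to zero -/

/-- The difference of two sequences with alternating signs. For two profiles with `c 1 ≤ d 1` these
signs make all its entries non-negative. -/
def alternatingDiff (c d : ℕ → ℝ) (n : ℕ) : ℝ := (-1) ^ n * (c n - d n)

namespace IsDyadicProfile

section Uniqueness

variable {c d : ℕ → ℝ}

lemma alternatingDiff_add_two_mul (hc : IsDyadicProfile c) (hd : IsDyadicProfile d) (n : ℕ) :
    alternatingDiff c d (n + 2) * (c (n + 1) + d (n + 1)) =
      alternatingDiff c d n * (c n + d n) +
        alternatingDiff c d (n + 1) * (c (n + 2) + d (n + 2) - 1 / dyadicK n) := by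
  have hk := dyadicK_pos n
  have hrc := hc.recurrence n
  have hrd := hd.recurrence n
  rw [dyadicK_succ] at hrc hrd
  simp only [alternatingDiff, pow_succ]
  field_simp
  linear_combination hrc - hrd

lemma dyadicK_gap_nonneg (hc : IsDyadicProfile c) (hd : IsDyadicProfile d) (hc1 : 0 < c 1)
    (hd1 : 0 < d 1) (n : ℕ) : 0 ≤ c (n + 2) + d (n + 2) - 1 / dyadicK n := by
  have hhalf : 1 / dyadicK n = 2 * (1 / dyadicK (n + 1)) := by
    rw [dyadicK_succ]
    ring
  linarith [hc.one_div_dyadicK_le hc1 n, hd.one_div_dyadicK_le hd1 n]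

lemma alternatingDiff_nonneg (hc : IsDyadicProfile c) (hd : IsDyadicProfile d) (hc1 : 0 < c 1)
    (h : c 1 ≤ d 1) (n : ℕ) : 0 ≤ alternatingDiff c d n := by
  have hd1 := hc1.trans_le h
  induction n using Nat.twoStepInduction with
  | zero => simp [alternatingDiff, hc.zero, hd.zero]
  | one => simpa [alternatingDiff] using h
  | more n ih ih' =>
    have hgap := hc.dyadicK_gap_nonneg hd hc1 hd1 n
    have hsum : 0 ≤ c n + d n := by
      cases n with
      | zero => simp [hc.zero, hd.zero]
      | succ n => exact (add_pos (hc.pos hc1 n) (hd.pos hd1 n)).le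
    refine nonneg_of_mul_nonneg_left ?_ (add_pos (hc.pos hc1 n) (hd.pos hd1 n))
    rw [hc.alternatingDiff_add_two_mul hd]
    positivity

lemma alternatingDiff_mul_le (hc : IsDyadicProfile c) (hd : IsDyadicProfile d) (hc1 : 0 < c 1)
    (h : c 1 ≤ d 1) (n : ℕ) :
    alternatingDiff c d n * (c n + d n) ≤
      alternatingDiff c d (n + 2) * (c (n + 1) + d (n + 1)) := by
  rw [hc.alternatingDiff_add_two_mul hd]
  exact le_add_of_nonneg_right (mul_nonneg (hc.alternatingDiff_nonneg hd hc1 h _)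
    (hc.dyadicK_gap_nonneg hd hc1 (hc1.trans_le h) n))

lemma alternatingDiff_product_le_add_two (hc : IsDyadicProfile c) (hd : IsDyadicProfile d)
    (hc1 : 0 < c 1) (h : c 1 ≤ d 1) (n : ℕ) :
    alternatingDiff c d n * alternatingDiff c d (n + 1) * (c n + d n) ≤
      alternatingDiff c d (n + 2) * alternatingDiff c d (n + 3) * (c (n + 2) + d (n + 2)) := by
  have hsum (n : ℕ) : 0 < c (n + 1) + d (n + 1) :=
    add_pos (hc.pos hc1 n) (hd.pos (hc1.trans_le h) n)
  have hδ := hc.alternatingDiff_nonneg hd hc1 h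
  refine le_of_mul_le_mul_right ?_ (hsum n)
  calc alternatingDiff c d n * alternatingDiff c d (n + 1) * (c n + d n) * (c (n + 1) + d (n + 1))
      = (alternatingDiff c d n * (c n + d n)) *
          (alternatingDiff c d (n + 1) * (c (n + 1) + d (n + 1))) := by ring
    _ ≤ (alternatingDiff c d (n + 2) * (c (n + 1) + d (n + 1))) *
          (alternatingDiff c d (n + 3) * (c (n + 2) + d (n + 2))) :=
        mul_le_mul (hc.alternatingDiff_mul_le hd hc1 h n)
          (hc.alternatingDiff_mul_le hd hc1 h (n + 1)) (mul_nonneg (hδ _) (hsum n).le)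
          (mul_nonneg (hδ _) (hsum n).le)
    _ = _ := by ring

lemma alternatingDiff_product_three_pos (hc : IsDyadicProfile c) (hd : IsDyadicProfile d)
    (hc1 : 0 < c 1) (h : c 1 < d 1) :
    0 < alternatingDiff c d 3 * alternatingDiff c d 4 * (c 3 + d 3) := by
  have hd1 := hc1.trans h
  have hsum (n : ℕ) : 0 < c (n + 1) + d (n + 1) := add_pos (hc.pos hc1 n) (hd.pos hd1 n)
  have hδ1 : 0 < alternatingDiff c d 1 := by simpa [alternatingDiff] using h
  have hδ3 : 0 < alternatingDiff c d 3 :=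
    pos_of_mul_pos_left ((mul_pos hδ1 (hsum 0)).trans_le (hc.alternatingDiff_mul_le hd hc1 h.le 1))
      (hsum 1).le
  have hδ4 : 0 < alternatingDiff c d 4 := by
    have hgap : 0 < c 4 + d 4 - 1 / dyadicK 2 := by
      have hhalf : 1 / dyadicK 2 = 2 * (1 / dyadicK 3) := by norm_num [dyadicK]
      linarith [hc.one_div_dyadicK_lt hc1 1, hd.one_div_dyadicK_lt hd1 1]
    refine pos_of_mul_pos_left (b := c 3 + d 3) ?_ (hsum 2).le
    rw [hc.alternatingDiff_add_two_mul hd 2]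
    exact add_pos_of_nonneg_of_pos
      (mul_nonneg (hc.alternatingDiff_nonneg hd hc1 h.le 2) (hsum 1).le) (mul_pos hδ3 hgap)
  exact mul_pos (mul_pos hδ3 hδ4) (hsum 2)

lemma le_of_tendsto_zero (hc : IsDyadicProfile c) (hd : IsDyadicProfile d) (hc1 : 0 < c 1)
    (hct : Tendsto c atTop (𝓝 0)) (hdt : Tendsto d atTop (𝓝 0)) : d 1 ≤ c 1 := by
  by_contra! h
  set P : ℕ → ℝ := fun n =>
    alternatingDiff c d n * alternatingDiff c d (n + 1) * (c n + d n)
  have hδt : Tendsto (alternatingDiff c d) atTop (𝓝 0) := by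
    refine squeeze_zero_norm (a := fun n => |c n - d n|) (fun n => ?_) ?_
    · simp [alternatingDiff]
    · simpa using (hct.sub hdt).abs
  have hPt : Tendsto P atTop (𝓝 0) := by
    simpa using (hδt.mul (hδt.comp (tendsto_add_atTop_nat 1))).mul (hct.add hdt)
  have hmono : Monotone fun k => P (2 * k + 3) :=
    monotone_nat_of_le_succ fun k =>
      hc.alternatingDiff_product_le_add_two hd hc1 h.le (2 * k + 3)
  have hodd : Tendsto (fun k : ℕ => 2 * k + 3) atTop atTop :=
    tendsto_atTop_mono (fun k => show k ≤ 2 * k + 3 by omega) tendsto_id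
  exact (hc.alternatingDiff_product_three_pos hd hc1 h).not_ge
    (hmono.ge_of_tendsto (hPt.comp hodd) 0)

lemma eq_of_one_eq (hc : IsDyadicProfile c) (hd : IsDyadicProfile d) (hc1 : 0 < c 1)
    (h : c 1 = d 1) : c = d := by
  funext n
  induction n using Nat.twoStepInduction with
  | zero => rw [hc.zero, hd.zero]
  | one => exact h
  | more n ih ih' => rw [hc.add_two_eq hc1, hd.add_two_eq (h ▸ hc1), ih, ih']

theorem eq_of_tendsto_zero (hc : IsDyadicProfile c) (hd : IsDyadicProfile d) (hc1 : 0 < c 1)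
    (hd1 : 0 < d 1) (hct : Tendsto c atTop (𝓝 0)) (hdt : Tendsto d atTop (𝓝 0)) : c = d :=
  hc.eq_of_one_eq hd hc1 <|
    (hd.le_of_tendsto_zero hc hd1 hdt hct).antisymm (hc.le_of_tendsto_zero hd hc1 hct hdt)

end Uniqueness

end IsDyadicProfile

/-! ### Existence of a square summable profile by shooting -/

lemma summable_of_add_two_le {f : ℕ → ℝ} {r : ℝ} (hf : ∀ n, 0 ≤ f n) (hr : r < 1)
    (h : ∀ n, f (n + 2) ≤ r * f n) : Summable f := by
  have hsqrt : √r < 1 := (Real.sqrt_lt' one_pos).2 (by simpa using hr)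
  have hr_le : r ≤ √r * √r := by
    rcases le_total 0 r with h0 | h0
    · exact (Real.mul_self_sqrt h0).ge
    · exact h0.trans (mul_self_nonneg _)
  have hS : ∀ n, 0 ≤ √r * f n + f (n + 1) := fun n =>
    add_nonneg (mul_nonneg (Real.sqrt_nonneg r) (hf n)) (hf (n + 1))
  have hsum : Summable fun n => √r * f n + f (n + 1) := by
    refine summable_of_ratio_norm_eventually_le hsqrt (Eventually.of_forall fun n => ?_)
    rw [Real.norm_of_nonneg (hS _), Real.norm_of_nonneg (hS _)]
    linarith [h n, mul_le_mul_of_nonneg_right hr_le (hf n)]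
  refine (summable_nat_add_iff 1).1 (hsum.of_nonneg_of_le (fun n => hf (n + 1)) fun n => ?_)
  exact le_add_of_nonneg_left (mul_nonneg (Real.sqrt_nonneg r) (hf n))

namespace IsDyadicProfile

section Monotonicity

variable {c : ℕ → ℝ}

lemma one_div_dyadicK_add_three_le (hc : IsDyadicProfile c) (h1 : 0 < c 1) (n : ℕ) :
    1 / dyadicK (n + 3) ≤ c (n + 2) / 4 := by
  calc 1 / dyadicK (n + 3) = 1 / dyadicK (n + 1) / 4 := by
        rw [dyadicK_succ, dyadicK_succ]
        ring
    _ ≤ c (n + 2) / 4 := by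
        gcongr
        exact hc.one_div_dyadicK_le h1 n

lemma add_three_le_of_le (hc : IsDyadicProfile c) (h1 : 0 < c 1) {n : ℕ}
    (h : c (n + 1) ≤ c (n + 2)) : c (n + 3) ≤ 1 / dyadicK (n + 2) + c (n + 2) / 2 := by
  have hn : 0 < c (n + 1) := hc.pos h1 n
  have hn' : 0 < c (n + 2) := hc.pos h1 _
  calc c (n + 3) = 1 / dyadicK (n + 2) + c (n + 1) ^ 2 / (2 * c (n + 2)) := hc.add_two_eq h1 _
    _ ≤ 1 / dyadicK (n + 2) + c (n + 2) ^ 2 / (2 * c (n + 2)) := by gcongr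
    _ = 1 / dyadicK (n + 2) + c (n + 2) / 2 := by
      field_simp

lemma lt_and_lt_of_le (hc : IsDyadicProfile c) (h1 : 0 < c 1) {n : ℕ}
    (h : c (n + 2) ≤ c (n + 3)) : c (n + 4) < c (n + 3) ∧ c (n + 4) < c (n + 5) := by
  have h3 : 0 < c (n + 3) := hc.pos h1 _
  have h4 : 0 < c (n + 4) := hc.pos h1 _
  have hw : 1 / dyadicK (n + 3) ≤ c (n + 3) / 4 := by
    linarith [hc.one_div_dyadicK_add_three_le h1 n]
  have hle : c (n + 4) ≤ 1 / dyadicK (n + 3) + c (n + 3) / 2 := hc.add_three_le_of_le h1 h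
  refine ⟨by linarith, ?_⟩
  have hratio : 2 / 3 * c (n + 3) ≤ c (n + 3) ^ 2 / (2 * c (n + 4)) := by
    rw [le_div_iff₀ (mul_pos two_pos h4)]
    nlinarith
  calc c (n + 4) ≤ 1 / dyadicK (n + 3) + c (n + 3) / 2 := hle
    _ < 1 / dyadicK (n + 3) / 2 + 2 / 3 * c (n + 3) := by linarith
    _ = 1 / dyadicK (n + 4) + 2 / 3 * c (n + 3) := by
      rw [dyadicK_succ (n + 3)]
      ring
    _ ≤ 1 / dyadicK (n + 4) + c (n + 3) ^ 2 / (2 * c (n + 4)) := by gcongr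
    _ = c (n + 5) := (hc.add_two_eq h1 (n + 3)).symm

lemma le_add_two_mul (hc : IsDyadicProfile c) (h1 : 0 < c 1) {n : ℕ}
    (h : c (n + 2) ≤ c (n + 3)) (i : ℕ) : c (n + 2 * i + 2) ≤ c (n + 2 * i + 3) := by
  induction i with
  | zero => exact h
  | succ i ih => exact (hc.lt_and_lt_of_le h1 ih).2.le

lemma even_iff_even_of_le (hc : IsDyadicProfile c) (h1 : 0 < c 1) {m n : ℕ}
    (hm : c (m + 2) ≤ c (m + 3)) (hn : c (n + 2) ≤ c (n + 3)) : Even m ↔ Even n := by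
  wlog hmn : m ≤ n generalizing m n
  · exact (this hn hm (le_of_not_ge hmn)).symm
  obtain ⟨k, rfl⟩ := Nat.exists_eq_add_of_le hmn
  obtain ⟨i, rfl | rfl⟩ := Nat.even_or_odd' k
  · simp [Nat.even_add]
  · exact absurd hn (hc.lt_and_lt_of_le h1 (hc.le_add_two_mul h1 hm i)).1.not_ge

lemma add_four_le_of_le (hc : IsDyadicProfile c) (h1 : 0 < c 1) {n : ℕ}
    (h : c (n + 4) ≤ c (n + 3)) : c (n + 4) ≤ 7 / 8 * c (n + 2) := by
  have h2 : 0 < c (n + 2) := hc.pos h1 _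
  have h3 : 0 < c (n + 3) := hc.pos h1 _
  have hw := hc.one_div_dyadicK_add_three_le h1 n
  by_contra! hlt
  have hquot : c (n + 2) ^ 2 / (2 * c (n + 3)) ≤ 4 / 7 * c (n + 2) := by
    rw [div_le_iff₀ (mul_pos two_pos h3)]
    nlinarith
  have heq : c (n + 4) = 1 / dyadicK (n + 3) + c (n + 2) ^ 2 / (2 * c (n + 3)) :=
    hc.add_two_eq h1 _
  linarith

lemma summable_sq_of_forall_le (hc : IsDyadicProfile c) (h1 : 0 < c 1)
    (h : ∀ n, c (n + 3) ≤ c (n + 2)) : Summable fun n => c n ^ 2 := by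
  refine (summable_nat_add_iff 2).1 <|
    summable_of_add_two_le (r := (7 / 8) ^ 2) (fun n => sq_nonneg _) (by norm_num) fun n => ?_
  rw [← mul_pow]
  exact pow_le_pow_left₀ (hc.pos h1 _).le (hc.add_four_le_of_le h1 (h (n + 1))) 2

end Monotonicity

end IsDyadicProfile

/-- The solution of the profile recurrence with first entry `x`. It is a profile for `0 < x`; the
shooting argument varies `x`. -/
noncomputable def dyadicProfile (x : ℝ) : ℕ → ℝ
  | 0 => 0
  | 1 => x
  | n + 2 => 1 / dyadicK (n + 1) + dyadicProfile x n ^ 2 / (2 * dyadicProfile x (n + 1))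

section Shooting

lemma dyadicProfile_zero (x : ℝ) : dyadicProfile x 0 = 0 := by rw [dyadicProfile]

lemma dyadicProfile_one (x : ℝ) : dyadicProfile x 1 = x := by rw [dyadicProfile]

lemma dyadicProfile_add_two (x : ℝ) (n : ℕ) : dyadicProfile x (n + 2) =
    1 / dyadicK (n + 1) + dyadicProfile x n ^ 2 / (2 * dyadicProfile x (n + 1)) := by
  rw [dyadicProfile]

variable {x : ℝ}

lemma dyadicProfile_pos (hx : 0 < x) (n : ℕ) : 0 < dyadicProfile x (n + 1) := by
  induction n with
  | zero => rwa [dyadicProfile_one]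
  | succ n ih =>
    rw [dyadicProfile_add_two]
    exact add_pos_of_pos_of_nonneg (one_div_pos.2 (dyadicK_pos _)) (by positivity)

lemma isDyadicProfile_dyadicProfile (hx : 0 < x) : IsDyadicProfile (dyadicProfile x) where
  zero := dyadicProfile_zero x
  recurrence n := by
    have hk := dyadicK_pos n
    have hp := dyadicProfile_pos hx n
    rw [dyadicProfile_add_two, dyadicK_succ]
    field_simp

lemma continuousOn_dyadicProfile (n : ℕ) :
    ContinuousOn (fun x => dyadicProfile x n) (Ioi 0) := by
  induction n using Nat.twoStepInduction with
  | zero => simpa only [dyadicProfile_zero] using continuousOn_const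
  | one =>
    simp only [dyadicProfile_one]
    exact continuousOn_id
  | more n ih ih' =>
    simp only [dyadicProfile_add_two]
    exact continuousOn_const.add ((ih.pow 2).div (continuousOn_const.mul ih') fun x hx =>
      (mul_pos two_pos (dyadicProfile_pos hx n)).ne')

/-- The initial values `x > 0` whose profile increases from entry `n + 2` to entry `n + 3` for some
`n` satisfying `p`; the shooting argument compares `p = Even` with `p = Odd`. -/
def risingSet (p : ℕ → Prop) : Set ℝ :=
  {x | 0 < x ∧ ∃ n, p n ∧ dyadicProfile x (n + 2) < dyadicProfile x (n + 3)}

lemma isOpen_risingSet (p : ℕ → Prop) : IsOpen (risingSet p) := by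
  have h : risingSet p = ⋃ (n) (_ : p n), Ioi 0 ∩
      (fun x => dyadicProfile x (n + 3) - dyadicProfile x (n + 2)) ⁻¹' Ioi 0 := by
    ext x
    simp [risingSet]
  rw [h]
  exact isOpen_biUnion fun n _ => ((continuousOn_dyadicProfile _).sub
    (continuousOn_dyadicProfile _)).isOpen_inter_preimage isOpen_Ioi isOpen_Ioi

lemma disjoint_risingSet_even_odd : Disjoint (risingSet Even) (risingSet Odd) := by
  refine disjoint_left.2 ?_
  rintro x ⟨hx, m, hm, hlt⟩ ⟨-, n, hn, hlt'⟩
  exact Nat.not_even_iff_odd.2 hn <| ((isDyadicProfile_dyadicProfile hx).even_iff_even_of_le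
    (dyadicProfile_pos hx 0) hlt.le hlt'.le).1 hm

lemma exists_forall_dyadicProfile_le :
    ∃ x > 0, ∀ n, dyadicProfile x (n + 3) ≤ dyadicProfile x (n + 2) := by
  by_contra! hrise
  have hcover : Ioi 0 ⊆ risingSet Even ∪ risingSet Odd := fun x hx => by
    obtain ⟨n, hn⟩ := hrise x hx
    exact (Nat.even_or_odd n).imp (fun h => ⟨hx, n, h, hn⟩) fun h => ⟨hx, n, h, hn⟩
  have heven : 1 ∈ risingSet Even :=
    ⟨one_pos, 0, Even.zero, by norm_num [dyadicProfile, dyadicK]⟩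
  have hodd : 1 / 4 ∈ risingSet Odd :=
    ⟨by norm_num, 1, odd_one, by norm_num [dyadicProfile, dyadicK]⟩
  obtain ⟨x, -, hxe, hxo⟩ := isPreconnected_Ioi _ _ (isOpen_risingSet Even)
    (isOpen_risingSet Odd) hcover ⟨1, heven.1, heven⟩ ⟨1 / 4, hodd.1, hodd⟩
  exact disjoint_left.1 disjoint_risingSet_even_odd hxe hxo

theorem exists_isDyadicProfile_summable_sq :
    ∃ c, IsDyadicProfile c ∧ 0 < c 1 ∧ Summable fun n => c n ^ 2 := by
  obtain ⟨x, hx, hle⟩ := exists_forall_dyadicProfile_le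
  have hc := isDyadicProfile_dyadicProfile hx
  have h1 : 0 < dyadicProfile x 1 := dyadicProfile_pos hx 0
  exact ⟨_, hc, h1, hc.summable_sq_of_forall_le h1 hle⟩

end Shooting

/-! ### Leading zeros -/

/-- Profiles of finite energy whose first non-zero entry, of index `n₀ + 1`, is positive. -/
structure IsFiniteEnergyProfile (n₀ : ℕ) (a : ℕ → ℝ) : Prop extends IsDyadicProfile a where
  eq_zero_of_le : ∀ n ≤ n₀, a n = 0
  leading_pos : 0 < a (n₀ + 1)
  summable_sq : Summable fun n => a n ^ 2

namespace IsDyadicProfile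

variable {a : ℕ → ℝ}

-- For `n < n₀` the truncated subtraction gives `a 0 = 0`.
lemma shift (ha : IsDyadicProfile a) (n₀ : ℕ) :
    IsDyadicProfile fun n => a (n - n₀) / dyadicK n₀ where
  zero := by simp [ha.zero]
  recurrence n := by
    rcases lt_or_ge n n₀ with h | h
    · simp [Nat.sub_eq_zero_of_le h, Nat.sub_eq_zero_of_le h.le, ha.zero]
    · obtain ⟨j, rfl⟩ := Nat.exists_eq_add_of_le h
      have hk := dyadicK_pos n₀
      simp only [add_assoc, Nat.add_sub_cancel_left, dyadicK_add n₀]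
      field_simp
      linear_combination ha.recurrence j

lemma unshift (ha : IsDyadicProfile a) {n₀ : ℕ} (h : a n₀ = 0) :
    IsDyadicProfile fun n => dyadicK n₀ * a (n₀ + n) where
  zero := by simp [h]
  recurrence n := by
    have hr := ha.recurrence (n₀ + n)
    rw [add_assoc n₀ n 1, add_assoc n₀ n 2, dyadicK_add n₀ (n + 1), dyadicK_add n₀ n] at hr
    linear_combination dyadicK n₀ * hr

end IsDyadicProfile

lemma exists_isFiniteEnergyProfile (n₀ : ℕ) : ∃ a, IsFiniteEnergyProfile n₀ a := by
  obtain ⟨c, hc, h1, hs⟩ := exists_isDyadicProfile_summable_sq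
  refine ⟨_, hc.shift n₀, fun n hn => ?_, ?_, (summable_nat_add_iff n₀).1 ?_⟩
  · simp [Nat.sub_eq_zero_of_le hn, hc.zero]
  · simpa using div_pos h1 (dyadicK_pos n₀)
  · simpa only [Nat.add_sub_cancel, div_pow] using hs.div_const (dyadicK n₀ ^ 2)

namespace IsFiniteEnergyProfile

variable {n₀ : ℕ} {a b : ℕ → ℝ}

lemma unshift (ha : IsFiniteEnergyProfile n₀ a) :
    IsDyadicProfile fun n => dyadicK n₀ * a (n₀ + n) :=
  ha.toIsDyadicProfile.unshift (ha.eq_zero_of_le n₀ le_rfl)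

lemma unshift_one_pos (ha : IsFiniteEnergyProfile n₀ a) : 0 < dyadicK n₀ * a (n₀ + 1) :=
  mul_pos (dyadicK_pos n₀) ha.leading_pos

lemma pos (ha : IsFiniteEnergyProfile n₀ a) {n : ℕ} (hn : n₀ < n) : 0 < a n := by
  obtain ⟨j, rfl⟩ := Nat.exists_eq_add_of_lt hn
  exact pos_of_mul_pos_right (ha.unshift.pos ha.unshift_one_pos j) (dyadicK_pos n₀).le

lemma nonneg (ha : IsFiniteEnergyProfile n₀ a) (n : ℕ) : 0 ≤ a n :=
  (le_or_gt n n₀).elim (fun h => (ha.eq_zero_of_le n h).ge) fun h => (ha.pos h).le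

lemma tendsto_zero (ha : IsFiniteEnergyProfile n₀ a) : Tendsto a atTop (𝓝 0) := by
  simpa [Real.sqrt_sq (ha.nonneg _)] using ha.summable_sq.tendsto_atTop_zero.sqrt

lemma unshift_tendsto_zero (ha : IsFiniteEnergyProfile n₀ a) :
    Tendsto (fun n => dyadicK n₀ * a (n₀ + n)) atTop (𝓝 0) := by
  simpa [add_comm] using
    (ha.tendsto_zero.comp (tendsto_add_atTop_nat n₀)).const_mul (dyadicK n₀)

theorem eq (ha : IsFiniteEnergyProfile n₀ a) (hb : IsFiniteEnergyProfile n₀ b) : a = b := by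
  have h := ha.unshift.eq_of_tendsto_zero hb.unshift ha.unshift_one_pos hb.unshift_one_pos
    ha.unshift_tendsto_zero hb.unshift_tendsto_zero
  funext n
  rcases le_total n n₀ with hn | hn
  · rw [ha.eq_zero_of_le n hn, hb.eq_zero_of_le n hn]
  · obtain ⟨j, rfl⟩ := Nat.exists_eq_add_of_le hn
    exact mul_left_cancel₀ (dyadicK_pos n₀).ne' (congrFun h j)

lemma hasLeadingIndex (ha : IsFiniteEnergyProfile n₀ a) : HasLeadingIndex n₀ a :=
  ⟨fun n _ hn => ha.eq_zero_of_le n hn, ha.leading_pos.ne'⟩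

end IsFiniteEnergyProfile

/-! ### Profiles and solutions -/

section Solutions

variable {I : Set ℝ} {τ s : ℝ} {n₀ : ℕ} {a b : ℕ → ℝ} {X : ℕ → ℝ → ℝ}

lemma hasDerivAt_div_sub (c : ℝ) (hs : s ≠ τ) :
    HasDerivAt (fun t => c / (t - τ)) (-c / (s - τ) ^ 2) s := by
  have hne : s - τ ≠ 0 := sub_ne_zero.2 hs
  simpa using (hasDerivAt_const s c).fun_div ((hasDerivAt_id s).sub_const τ) hne

lemma IsDyadicProfile.isDyadicSolutionOn (ha : IsDyadicProfile a) (hτ : τ ∉ I) :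
    IsDyadicSolutionOn I fun n t => a n / (t - τ) where
  zero t _ := by simp [ha.zero]
  contDiffOn n := contDiffOn_const.div (by fun_prop)
    fun t ht => sub_ne_zero.2 (ne_of_mem_of_not_mem ht hτ)
  equation n t ht := by
    have hne : t ≠ τ := ne_of_mem_of_not_mem ht hτ
    refine (hasDerivAt_div_sub (a (n + 1)) hne).hasDerivWithinAt.congr_deriv ?_
    have hne' : t - τ ≠ 0 := sub_ne_zero.2 hne
    field_simp
    linear_combination ha.recurrence n

lemma IsDyadicSolutionOn.isDyadicProfile (hX : IsDyadicSolutionOn I X)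
    (hb : ∀ n, 1 ≤ n → ∀ t ∈ I, X n t = b n / (t - τ)) (hs : s ∈ I)
    (hI : UniqueDiffWithinAt ℝ I s) (hτ : s ≠ τ) : IsDyadicProfile fun n => X n s * (s - τ) where
  zero := by simp [hX.zero s hs]
  recurrence n := by
    have hne : s - τ ≠ 0 := sub_ne_zero.2 hτ
    have hbn := hb (n + 1) n.succ_pos
    have hderiv := hI.eq_deriv _ (hX.equation n s hs)
      ((hasDerivAt_div_sub (b (n + 1)) hτ).hasDerivWithinAt.congr hbn (hbn s hs))
    have hval : b (n + 1) = X (n + 1) s * (s - τ) := ((eq_div_iff hne).1 (hbn s hs)).symm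
    rw [hval] at hderiv
    field_simp at hderiv
    linear_combination (-(s - τ)) * hderiv

lemma IsFiniteEnergyProfile.isSelfSimilarSolutionWith (ha : IsFiniteEnergyProfile n₀ a)
    (hτ : τ ∉ I) : IsSelfSimilarSolutionWith I τ n₀ a fun n t => a n / (t - τ) := by
  refine ⟨ha.isDyadicSolutionOn hτ, fun t _ => ?_, ha.hasLeadingIndex, fun _ _ _ _ => rfl⟩
  simpa only [div_pow] using
    ((summable_nat_add_iff 1).2 ha.summable_sq).div_const ((t - τ) ^ 2)

lemma IsFiniteEnergyProfile.isNegativeOn (ha : IsFiniteEnergyProfile n₀ a) (hI : I ⊆ Iic τ) :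
    IsNegativeOn I fun n t => a n / (t - τ) :=
  fun n _ _ ht => div_nonpos_of_nonneg_of_nonpos (ha.nonneg n) (sub_nonpos.2 (hI ht))

lemma IsFiniteEnergyProfile.isPositiveOn (ha : IsFiniteEnergyProfile n₀ a) (hI : I ⊆ Ici τ) :
    IsPositiveOn I fun n t => a n / (t - τ) :=
  fun n _ _ ht => div_nonneg (ha.nonneg n) (sub_nonneg.2 (hI ht))

lemma IsSelfSimilarSolutionWith.isSelfSimilarSolutionOn
    (hX : IsSelfSimilarSolutionWith I τ n₀ b X) : IsSelfSimilarSolutionOn I n₀ X :=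
  ⟨hX.1, hX.2.1, b, fun t => (t - τ)⁻¹, hX.2.2.1, fun n hn t ht =>
    (hX.2.2.2 n hn t ht).trans (div_eq_mul_inv _ _)⟩

lemma IsSelfSimilarSolutionWith.isFiniteEnergyProfile (hX : IsSelfSimilarSolutionWith I τ n₀ b X)
    (hs : s ∈ I) (hI : UniqueDiffWithinAt ℝ I s) (hτ : s ≠ τ)
    (hsign : 0 ≤ X (n₀ + 1) s * (s - τ)) :
    IsFiniteEnergyProfile n₀ fun n => X n s * (s - τ) := by
  obtain ⟨hsol, henergy, ⟨hzero, hlead⟩, hform⟩ := hX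
  have hne : s - τ ≠ 0 := sub_ne_zero.2 hτ
  refine ⟨hsol.isDyadicProfile hform hs hI hτ, fun n hn => ?_, hsign.lt_of_ne' ?_, ?_⟩
  · rcases n.eq_zero_or_pos with rfl | hpos
    · simp [hsol.zero s hs]
    · simp [hform n hpos s hs, hzero n hpos hn]
  · rwa [hform _ n₀.succ_pos s hs, div_mul_cancel₀ _ hne]
  · have hsum : Summable fun n => X n s ^ 2 := (summable_nat_add_iff 1).1 (henergy s hs)
    simpa only [mul_pow] using hsum.mul_right ((s - τ) ^ 2)

theorem IsSelfSimilarSolutionWith.eq_div_sub (hX : IsSelfSimilarSolutionWith I τ n₀ b X)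
    (ha : IsFiniteEnergyProfile n₀ a) (hs : s ∈ I) (hI : UniqueDiffWithinAt ℝ I s) (hτ : s ≠ τ)
    (hsign : 0 ≤ X (n₀ + 1) s * (s - τ)) :
    (∀ n, 1 ≤ n → b n = a n) ∧ ∀ n, ∀ t ∈ I, X n t = a n / (t - τ) := by
  have heq (n : ℕ) : X n s * (s - τ) = a n :=
    congrFun ((hX.isFiniteEnergyProfile hs hI hτ hsign).eq ha) n
  obtain ⟨hsol, -, -, hform⟩ := hX
  have hb (n : ℕ) (hn : 1 ≤ n) : b n = a n := by
    rw [← heq, hform n hn s hs, div_mul_cancel₀ _ (sub_ne_zero.2 hτ)]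
  refine ⟨hb, fun n t ht => ?_⟩
  rcases n.eq_zero_or_pos with rfl | hn
  · rw [hsol.zero t ht, ha.zero, zero_div]
  · rw [hform n hn t ht, hb n hn]

theorem IsSelfSimilarSolutionWith.eq_div_sub_of_isNegativeOn {T : ℝ}
    (hX : IsSelfSimilarSolutionWith (Ico 0 T) τ n₀ b X) (hneg : IsNegativeOn (Ico 0 T) X)
    (ha : IsFiniteEnergyProfile n₀ a) (hT : 0 < T) (hτ : T ≤ τ) :
    (∀ n, 1 ≤ n → b n = a n) ∧ ∀ n, ∀ t ∈ Ico 0 T, X n t = a n / (t - τ) := by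
  have h0 : (0 : ℝ) ∈ Ico 0 T := ⟨le_rfl, hT⟩
  exact hX.eq_div_sub ha h0 (uniqueDiffOn_Ico 0 T 0 h0) (hT.trans_le hτ).ne
    (mul_nonneg_of_nonpos_of_nonpos (hneg _ n₀.succ_pos 0 h0) (by linarith))

theorem IsSelfSimilarSolutionWith.eq_div_sub_of_isPositiveOn
    (hX : IsSelfSimilarSolutionWith (Ioi τ) τ n₀ b X) (hpos : IsPositiveOn (Ioi τ) X)
    (ha : IsFiniteEnergyProfile n₀ a) : ∀ n, ∀ t ∈ Ioi τ, X n t = a n / (t - τ) := by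
  have hs : τ + 1 ∈ Ioi τ := lt_add_one τ
  exact (hX.eq_div_sub ha hs (uniqueDiffOn_Ioi τ _ hs) hs.ne'
    (mul_nonneg (hpos _ n₀.succ_pos _ hs) (by simp))).2

end Solutions

lemma tendsto_div_sub_atBot {c : ℝ} (hc : 0 < c) (τ : ℝ) :
    Tendsto (fun t => c / (t - τ)) (𝓝[<] τ) atBot := by
  have h : Tendsto (fun t => t - τ) (𝓝[<] τ) (𝓝[<] 0) := by
    refine tendsto_nhdsWithin_iff.2 ⟨?_, ?_⟩
    · exact ((continuous_sub_right τ).tendsto' τ 0 (sub_self τ)).mono_left nhdsWithin_le_nhds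
    · filter_upwards [self_mem_nhdsWithin] with t ht using sub_neg.2 (mem_Iio.1 ht)
  simpa only [div_eq_mul_inv, Function.comp_def] using
    (tendsto_inv_nhdsLT_zero.comp h).const_mul_atBot hc

/-! ### The equation `ψ' = -μ ψ²` -/

section Riccati

variable {ψ : ℝ → ℝ} {μ a b : ℝ}

lemma hasDerivWithinAt_Ici_of_Ico {f : ℝ → ℝ} {f' t : ℝ} (h : HasDerivWithinAt f f' (Ico a b) t)
    (ht : t ∈ Ico a b) : HasDerivWithinAt f f' (Ici t) t :=
  h.mono_of_mem_nhdsWithin (Ico_mem_nhdsGE_of_mem ht)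

lemma eq_zero_of_riccati
    (hψ : ∀ t ∈ Ico a b, HasDerivWithinAt ψ (-μ * ψ t ^ 2) (Ico a b) t) (h0 : ψ a = 0) :
    ∀ t ∈ Ico a b, ψ t = 0 := by
  intro s hs
  have hsub : Icc a s ⊆ Ico a b := Icc_subset_Ico_right hs.2
  have hcont : ContinuousOn ψ (Icc a s) := fun t ht =>
    (hψ t (hsub ht)).continuousWithinAt.mono hsub
  obtain ⟨M, hM⟩ := isCompact_Icc.exists_bound_of_continuousOn hcont
  have hderiv : ∀ t ∈ Ico a s, HasDerivWithinAt ψ (-μ * ψ t ^ 2) (Ici t) t := fun t ht =>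
    have ht' := hsub (Ico_subset_Icc_self ht)
    hasDerivWithinAt_Ici_of_Ico (hψ t ht') ht'
  refine eq_zero_of_abs_deriv_le_mul_abs_self_of_eq_zero_right (K := |μ| * M) hcont hderiv h0
    (fun t ht => ?_) s (right_mem_Icc.2 hs.1)
  calc ‖-μ * ψ t ^ 2‖ = |μ| * ‖ψ t‖ * ‖ψ t‖ := by simp [sq, mul_assoc]
    _ ≤ |μ| * M * ‖ψ t‖ := by
      gcongr
      exact hM t (Ico_subset_Icc_self ht)

lemma neg_of_riccati (hμ : 0 ≤ μ)
    (hψ : ∀ t ∈ Ico a b, HasDerivWithinAt ψ (-μ * ψ t ^ 2) (Ico a b) t) (h0 : ψ a < 0) :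
    ∀ t ∈ Ico a b, ψ t < 0 := by
  have hanti : AntitoneOn ψ (Ico a b) :=
    antitoneOn_of_hasDerivWithinAt_nonpos (convex_Ico a b)
      (fun t ht => (hψ t ht).continuousWithinAt)
      (fun t ht => (hψ t (interior_subset ht)).mono interior_subset)
      fun t _ => mul_nonpos_of_nonpos_of_nonneg (neg_nonpos.2 hμ) (sq_nonneg _)
  exact fun t ht => (hanti ⟨le_rfl, ht.1.trans_lt ht.2⟩ ht ht.1).trans_lt h0

lemma inv_eq_of_riccati (hψ : ∀ t ∈ Ico a b, HasDerivWithinAt ψ (-μ * ψ t ^ 2) (Ico a b) t)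
    (hne : ∀ t ∈ Ico a b, ψ t ≠ 0) : ∀ t ∈ Ico a b, (ψ t)⁻¹ = (ψ a)⁻¹ + μ * (t - a) := by
  intro s hs
  have hderiv : ∀ t ∈ Ico a b, HasDerivWithinAt (fun t => (ψ t)⁻¹ - μ * t) 0 (Ico a b) t := by
    intro t ht
    have hψt := hne t ht
    refine (((hψ t ht).fun_inv hψt).fun_sub
      ((hasDerivWithinAt_id t _).const_mul μ)).congr_deriv ?_
    field_simp
    ring
  have hsub : Icc a s ⊆ Ico a b := Icc_subset_Ico_right hs.2
  have hconst := constant_of_has_deriv_right_zero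
    (fun t ht => (hderiv t (hsub ht)).continuousWithinAt.mono hsub)
    (fun t ht => have ht' := hsub (Ico_subset_Icc_self ht)
      hasDerivWithinAt_Ici_of_Ico (hderiv t ht') ht') s (right_mem_Icc.2 hs.1)
  linear_combination hconst

theorem exists_eq_one_div_of_riccati (hμ : 0 < μ)
    (hψ : ∀ t ∈ Ico a b, HasDerivWithinAt ψ (-μ * ψ t ^ 2) (Ico a b) t) (h0 : ψ a < 0) :
    ∃ τ, b ≤ τ ∧ ∀ t ∈ Ico a b, ψ t = 1 / (μ * (t - τ)) := by
  have hneg := neg_of_riccati hμ.le hψ h0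
  set τ := a - (μ * ψ a)⁻¹ with hτ
  have hform : ∀ t ∈ Ico a b, ψ t = 1 / (μ * (t - τ)) := by
    intro t ht
    have hψa := h0.ne
    rw [one_div, ← inv_eq_iff_eq_inv, inv_eq_of_riccati hψ (fun t ht => (hneg t ht).ne) t ht, hτ]
    field_simp
    ring
  have haτ : a ≤ τ := by
    have hinv : (μ * ψ a)⁻¹ < 0 := inv_lt_zero.2 (mul_neg_of_pos_of_neg hμ h0)
    linarith
  refine ⟨τ, not_lt.1 fun hτb => ?_, hform⟩
  exact (hneg τ ⟨haτ, hτb⟩).ne (by simp [hform τ ⟨haτ, hτb⟩])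

end Riccati

/-! ### Maximal solutions -/

section Maximal

variable {I : Set ℝ} {T τ s : ℝ} {n₀ : ℕ} {a : ℕ → ℝ} {X Z : ℕ → ℝ → ℝ}

lemma IsDyadicSolutionOn.eq_zero_of_add_one_eq_zero (hX : IsDyadicSolutionOn I X) {n : ℕ}
    (hzero : ∀ t ∈ I, X (n + 1) t = 0) (hs : s ∈ I) (hI : UniqueDiffWithinAt ℝ I s) :
    X n s = 0 := by
  have h := hI.eq_deriv _ (hX.equation n s hs)
    ((hasDerivWithinAt_const s I (0 : ℝ)).congr hzero (hzero s hs))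
  simpa [hzero s hs, (dyadicK_pos n).ne'] using h

lemma isSelfSimilarSolutionOn_zero (I : Set ℝ) (n₀ : ℕ) :
    IsSelfSimilarSolutionOn I n₀ fun _ _ => 0 := by
  refine ⟨⟨fun _ _ => rfl, fun _ => contDiffOn_const, fun n t _ => ?_⟩, fun _ _ => by simp,
    Pi.single (n₀ + 1) 1, 0, ⟨fun n _ hn => ?_, by simp⟩, by simp⟩
  · simpa using hasDerivWithinAt_const t I (0 : ℝ)
  · exact Pi.single_eq_of_ne (by omega) 1

namespace IsSelfSimilarSolutionOn

lemma eq_zero (hX : IsSelfSimilarSolutionOn I n₀ X) (hs : s ∈ I) : X n₀ s = 0 := by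
  obtain ⟨hsol, -, b, φ, hb, hform⟩ := hX
  rcases n₀.eq_zero_or_pos with rfl | hpos
  · exact hsol.zero s hs
  · rw [hform n₀ hpos s hs, hb.1 n₀ hpos le_rfl, zero_mul]

lemma exists_ratio (hX : IsSelfSimilarSolutionOn I n₀ X) :
    ∃ r, HasLeadingIndex n₀ r ∧ ∀ n, 1 ≤ n → ∀ t ∈ I, X n t = r n * X (n₀ + 1) t := by
  obtain ⟨-, -, b, φ, ⟨hzero, hlead⟩, hform⟩ := hX
  refine ⟨fun n => b n / b (n₀ + 1), ⟨fun n h1 hn => by simp [hzero n h1 hn], by simp [hlead]⟩,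
    fun n hn t ht => ?_⟩
  rw [hform n hn t ht, hform _ n₀.succ_pos t ht]
  field_simp

lemma hasDerivWithinAt_leading (hX : IsSelfSimilarSolutionOn I n₀ X) {r : ℝ}
    (hr : ∀ t ∈ I, X (n₀ + 2) t = r * X (n₀ + 1) t) :
    ∀ t ∈ I, HasDerivWithinAt (X (n₀ + 1))
      (-(dyadicK (n₀ + 1) * r) * X (n₀ + 1) t ^ 2) I t := by
  intro t ht
  refine (hX.1.equation n₀ t ht).congr_deriv ?_
  rw [hX.eq_zero ht, hr t ht]
  ring

end IsSelfSimilarSolutionOn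

namespace IsMaximalNegativeSelfSimilar

lemma exists_ne_zero (hZ : IsMaximalNegativeSelfSimilar T n₀ Z) :
    ∃ n, ∃ t ∈ Ico 0 T, Z n t ≠ 0 := by
  by_contra! h
  exact hZ.2.2 ⟨T + 1, lt_add_one T, _, isSelfSimilarSolutionOn_zero _ n₀, fun _ _ _ _ => le_rfl,
    fun n t ht => (h n t ht).symm⟩

lemma zero_mem (hZ : IsMaximalNegativeSelfSimilar T n₀ Z) : (0 : ℝ) ∈ Ico 0 T := by
  obtain ⟨-, t, ht, -⟩ := hZ.exists_ne_zero
  exact ⟨le_rfl, ht.1.trans_lt ht.2⟩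

lemma leading_neg (hZ : IsMaximalNegativeSelfSimilar T n₀ Z) : Z (n₀ + 1) 0 < 0 := by
  obtain ⟨r, -, hratio⟩ := hZ.1.exists_ratio
  obtain ⟨n, t, ht, hne⟩ := hZ.exists_ne_zero
  refine (hZ.2.1 _ n₀.succ_pos 0 hZ.zero_mem).lt_of_ne fun h0 => hne ?_
  rcases n.eq_zero_or_pos with rfl | hn
  · exact hZ.1.1.zero t ht
  · rw [hratio n hn t ht, eq_zero_of_riccati
      (hZ.1.hasDerivWithinAt_leading (hratio _ (n₀ + 1).succ_pos)) h0 t ht, mul_zero]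

lemma ratio_pos (hZ : IsMaximalNegativeSelfSimilar T n₀ Z) {r : ℝ}
    (hr : ∀ t ∈ Ico 0 T, Z (n₀ + 2) t = r * Z (n₀ + 1) t) : 0 < r := by
  have h0 := hZ.zero_mem
  have hneg := hZ.leading_neg
  have hnonneg : 0 ≤ r :=
    nonneg_of_mul_nonpos_left (hr 0 h0 ▸ hZ.2.1 _ (n₀ + 1).succ_pos 0 h0) hneg
  refine hnonneg.lt_of_ne' fun hr0 => hneg.ne ?_
  exact hZ.1.1.eq_zero_of_add_one_eq_zero (fun t ht => by rw [hr t ht, hr0, zero_mul]) h0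
    (uniqueDiffOn_Ico 0 T 0 h0)

theorem exists_isSelfSimilarSolutionWith (hZ : IsMaximalNegativeSelfSimilar T n₀ Z) :
    ∃ τ, T ≤ τ ∧ ∃ b, IsSelfSimilarSolutionWith (Ico 0 T) τ n₀ b Z := by
  obtain ⟨r, ⟨hzero, hlead⟩, hratio⟩ := hZ.1.exists_ratio
  have hnext := hratio (n₀ + 2) (n₀ + 1).succ_pos
  have hμ : 0 < dyadicK (n₀ + 1) * r (n₀ + 2) := mul_pos (dyadicK_pos _) (hZ.ratio_pos hnext)
  obtain ⟨τ, hτ, hform⟩ := exists_eq_one_div_of_riccati hμ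
    (hZ.1.hasDerivWithinAt_leading hnext) hZ.leading_neg
  refine ⟨τ, hτ, fun n => r n / (dyadicK (n₀ + 1) * r (n₀ + 2)), hZ.1.1, hZ.1.2.1,
    ⟨fun n h1 hn => by simp [hzero n h1 hn], div_ne_zero hlead hμ.ne'⟩, fun n hn t ht => ?_⟩
  rw [hratio n hn t ht, hform t ht, mul_one_div, div_div]

end IsMaximalNegativeSelfSimilar

namespace IsFiniteEnergyProfile

lemma isSelfSimilarSolutionOn_Ico (ha : IsFiniteEnergyProfile n₀ a) (T : ℝ) :
    IsSelfSimilarSolutionOn (Ico 0 T) n₀ fun n t => a n / (t - T) :=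
  (ha.isSelfSimilarSolutionWith right_notMem_Ico).isSelfSimilarSolutionOn

theorem isMaximalNegativeSelfSimilar (ha : IsFiniteEnergyProfile n₀ a) (hT : 0 < T) :
    IsMaximalNegativeSelfSimilar T n₀ fun n t => a n / (t - T) := by
  refine ⟨ha.isSelfSimilarSolutionOn_Ico T, ha.isNegativeOn fun t ht => ht.2.le, ?_⟩
  rintro ⟨T', hT', X', ⟨hX', -⟩, -, hext⟩
  have hcont : Tendsto (X' (n₀ + 1)) (𝓝[<] T) (𝓝 (X' (n₀ + 1) T)) :=
    ((hX'.contDiffOn _).continuousOn.continuousAt (Ico_mem_nhds hT hT')).mono_left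
      nhdsWithin_le_nhds
  refine not_tendsto_nhds_of_tendsto_atBot (tendsto_div_sub_atBot ha.leading_pos T) _
    (hcont.congr' ?_)
  filter_upwards [Ico_mem_nhdsLT hT] with t ht using hext _ t ht

theorem eq_of_isMaximalNegativeSelfSimilar (ha : IsFiniteEnergyProfile n₀ a)
    (hZ : IsMaximalNegativeSelfSimilar T n₀ Z) :
    ∀ n, ∀ t ∈ Ico 0 T, Z n t = a n / (t - T) := by
  obtain ⟨τ, hτ, b, hb⟩ := hZ.exists_isSelfSimilarSolutionWith
  have hform := (hb.eq_div_sub_of_isNegativeOn hZ.2.1 ha hZ.zero_mem.2 hτ).2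
  obtain rfl | hlt := hτ.eq_or_lt
  · exact hform
  · exact absurd ⟨τ, hlt, _, ha.isSelfSimilarSolutionOn_Ico τ,
      ha.isNegativeOn fun t ht => ht.2.le, fun n t ht => (hform n t ht).symm⟩ hZ.2.2

end IsFiniteEnergyProfile

end Maximal

theorem mainTheorem8 (t₀ : ℝ) (ht₀ : 0 < t₀) (n₀ : ℕ) :
    ∃ (a : ℕ → ℝ) (Y : ℕ → ℝ → ℝ),
      -- existence of a negative finite energy self-similar solution on `[0, t₀)`
      (IsSelfSimilarSolutionWith (Ico 0 t₀) t₀ n₀ a Y ∧ IsNegativeOn (Ico 0 t₀) Y) ∧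
      -- uniqueness, among solutions of the form `b_n / (t - t₀)`
      (∀ (b : ℕ → ℝ) (Z : ℕ → ℝ → ℝ),
        IsSelfSimilarSolutionWith (Ico 0 t₀) t₀ n₀ b Z → IsNegativeOn (Ico 0 t₀) Z →
          (∀ n, 1 ≤ n → b n = a n) ∧ ∀ n, ∀ t ∈ Ico 0 t₀, Z n t = Y n t) ∧
      -- the same, among all solutions of the form `b_n φ(t)` with maximal interval `[0, t₀)`
      (IsMaximalNegativeSelfSimilar t₀ n₀ Y ∧
        ∀ Z : ℕ → ℝ → ℝ, IsMaximalNegativeSelfSimilar t₀ n₀ Z →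
          ∀ n, ∀ t ∈ Ico 0 t₀, Z n t = Y n t) ∧
      -- every component that does not vanish identically is strictly negative and blows up
      (∀ n, n₀ < n →
        0 < a n ∧ (∀ t ∈ Ico 0 t₀, Y n t < 0) ∧ Tendsto (Y n) (𝓝[<] t₀) atBot) ∧
      -- `Y(t) = -X(-t)` for the positive finite energy self-similar solution `X` on `(-t₀, ∞)`
      (∃ X : ℕ → ℝ → ℝ,
        IsSelfSimilarSolutionWith (Ioi (-t₀)) (-t₀) n₀ a X ∧ IsPositiveOn (Ioi (-t₀)) X) ∧
      (∀ (b : ℕ → ℝ) (X : ℕ → ℝ → ℝ),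
        IsSelfSimilarSolutionWith (Ioi (-t₀)) (-t₀) n₀ b X → IsPositiveOn (Ioi (-t₀)) X →
          ∀ n, ∀ t ∈ Ico 0 t₀, Y n t = -X n (-t)) := by
  obtain ⟨a, ha⟩ := exists_isFiniteEnergyProfile n₀
  have hY := ha.isMaximalNegativeSelfSimilar ht₀
  refine ⟨a, fun n t => a n / (t - t₀),
    ⟨ha.isSelfSimilarSolutionWith right_notMem_Ico, hY.2.1⟩,
    fun b Z hZ hneg => hZ.eq_div_sub_of_isNegativeOn hneg ha ht₀ le_rfl,
    ⟨hY, fun Z hZ => ha.eq_of_isMaximalNegativeSelfSimilar hZ⟩,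
    fun n hn => ⟨ha.pos hn, fun t ht => div_neg_of_pos_of_neg (ha.pos hn) (sub_neg.2 ht.2),
      tendsto_div_sub_atBot (ha.pos hn) t₀⟩,
    ⟨_, ha.isSelfSimilarSolutionWith self_notMem_Ioi, ha.isPositiveOn Ioi_subset_Ici_self⟩,
    fun b X hX hpos n t ht => ?_⟩
  rw [hX.eq_div_sub_of_isPositiveOn hpos ha n (-t) (neg_lt_neg ht.2), ← div_neg]
  ring
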